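/- Let $K$ be an infinite commutative field (of any characteristic); all vector spaces and Lie algebras are over $K$ and of arbitrary dimension. **Formal series.** For vector spaces $E,F$, let $F[E]_m$ be the space of maps $f:E\to F$ of the form $f(x)=u(x,\dots,x)$ with $u:E^m\to F$ an $m$-linear map (one says that $u$ determines $f$), and let $F[[E]]=\prod_{m\ge 0}F[E]_m$. For $\xi\in E[[E]]$ and $f\in F[[E]]$, with components $\xi_r$ and $f_m$, the derivative $\xi.f\in F[[E]]$ has the components $(\xi.f)_s=\sum_{r+m=s+1}\xi_r.f_m$, where $(\xi_r.f_m)(x)=\sum_{i=1}^m u(x,\dots,x,\xi_r(x),x,\dots,x)$ (with $\xi_r(x)$ in the $i$-th place) if $u$ determines $f_m$; this does not depend on the choice of $u$. The space $S(X)=X[[X]]$ is a Lie algebra for the bracket $[\xi,\eta]=\xi.\eta-\eta.\xi$. A *formal action* of a Lie algebra $A$ on a vector space $X$ is a homomorphism of Lie algebras $A\to S(X)$, $a\mapsto D_a$. **Wreath product.** Let $A,B$ be Lie algebras, $X,Y$ vector spaces, and let $D:A\to S(X)$ and $d:B\to S(Y)$ be formal actions. The space $A[[Y]]$ is a Lie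 algebra for the pointwise bracket $[f,g]_s(y)=\sum_{m+n=s}[f_m(y),g_n(y)]$, on which $S(Y)$ acts by the derivations $f\mapsto\xi.f$. The wreath product $W(A,B;d)$ is the semidirect product of $A[[Y]]$ and $B$, that is, the vector space $A[[Y]]\times B$ with the bracket $$[(f,b),(g,c)]=\bigl([f,g]+d_b.g-d_c.f,\ [b,c]\bigr).$$ For $f\in A[[Y]]$, let $D_f\in S(X)[[Y]]$ be the series with components $y\mapsto D_{f_n(y)}$; it is seen as an element of $S(X\times Y)$ through the canonical embedding $S(X)[[Y]]\cong X[[X\times Y]]\subset S(X\times Y)$, so that its component of degree $r$ is $(x,y)\mapsto\bigl(\sum_{m+n=r}(D_{f_n(y)})_m(x),\,0\bigr)$. Likewise $d_b\in S(Y)$ is seen as the element of $S(X\times Y)$ with components $(x,y)\mapsto(0,(d_b)_r(y))$. **Theorem.** The map $$\Delta:W(A,B;d)\to S(X\times Y),\qquad \Delta_{(f,b)}=D_f+d_b,$$ is a formal action of the wreath product $W(A,B;d)$ on $X\times Y$, that is, a homomorphism of Lie algebras. It is given by the triangular formula $\Delta_{(f,b)}(x,y)=\bigl(D_{f(y)}(x),\,d_b(y)\bigr)$,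 that is, for all $r\ge 0$, $x\in X$, $y\in Y$, $$(\Delta_{(f,b)})_r(x,y)=\Bigl(\sum_{m+n=r}(D_{f_n(y)})_m(x),\ (d_b)_r(y)\Bigr).$$ -/

import Mathlib

open Finset

section Homogeneous

variable (K E F : Type*) [Field K] [AddCommGroup E] [Module K E] [AddCommGroup F] [Module K F]

/-- The space `F[E]_m` of homogeneous polynomials of degree `m`, with variables in `E` and
coefficients in `F`: the maps `x ↦ u (x, …, x)` with `u : E^m → F` an `m`-linear map. -/
def homPoly (m : ℕ) : Submodule K (E → F) where
  carrier := {f | ∃ u : MultilinearMap K (fun _ : Fin m => E) F, ∀ x, f x = u fun _ => x}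
  add_mem' := by
    rintro f g ⟨u, hu⟩ ⟨v, hv⟩
    exact ⟨u + v, fun x => by simp [hu, hv]⟩
  zero_mem' := ⟨0, fun x => by simp⟩
  smul_mem' := by
    rintro c f ⟨u, hu⟩
    exact ⟨c • u, fun x => by simp [hu]⟩

/-- Homogeneous polynomials of degree `m` from `E` to `F`, as a type. -/
abbrev HomPoly (m : ℕ) : Type _ := homPoly K E F m

end Homogeneous

section HomogeneousFacts

variable {K E F G H : Type*} [Field K] [AddCommGroup E] [Module K E] [AddCommGroup F] [Module K F]
  [AddCommGroup G] [Module K G] [AddCommGroup H] [Module K H]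

theorem homPoly_mem_of_card {ι : Type*} [Fintype ι] {m : ℕ} (h : Fintype.card ι = m)
    (u : MultilinearMap K (fun _ : ι => E) F) : (fun x => u fun _ => x) ∈ homPoly K E F m :=
  ⟨u.domDomCongr (Fintype.equivFinOfCardEq h), fun x => by simp⟩

/-- The multilinear map obtained from two multilinear maps and a bilinear map. -/
def multilinearProd {ι κ : Type*} (β : F →ₗ[K] G →ₗ[K] H)
    (u : MultilinearMap K (fun _ : ι => E) F) (v : MultilinearMap K (fun _ : κ => E) G) :
    MultilinearMap K (fun _ : ι ⊕ κ => E) H where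
  toFun z := β (u fun i => z (.inl i)) (v fun j => z (.inr j))
  map_update_add' := by
    let := Classical.decEq ι
    let := Classical.decEq κ
    rintro _ _ (_ | _) _ _ <;> simp
  map_update_smul' := by
    let := Classical.decEq ι
    let := Classical.decEq κ
    rintro _ _ (_ | _) _ _ <;> simp

theorem homPoly_bilin_mem (β : F →ₗ[K] G →ₗ[K] H) {m n : ℕ} {f : E → F} {g : E → G}
    (hf : f ∈ homPoly K E F m) (hg : g ∈ homPoly K E G n) :
    (fun x => β (f x) (g x)) ∈ homPoly K E H (m + n) := by
  obtain ⟨u, hu⟩ := hf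
  obtain ⟨v, hv⟩ := hg
  have := homPoly_mem_of_card (ι := Fin m ⊕ Fin n) (m := m + n) (by simp) (multilinearProd β u v)
  convert this using 2 with x
  simp [multilinearProd, hu, hv]

/-- Pre- and postcomposition of a homogeneous polynomial with linear maps. -/
theorem homPoly_comp_mem (s : F →ₗ[K] H) (p : G →ₗ[K] E) {m : ℕ} {f : E → F}
    (hf : f ∈ homPoly K E F m) : (fun x => s (f (p x))) ∈ homPoly K G H m := by
  obtain ⟨u, hu⟩ := hf
  exact ⟨s.compMultilinearMap (u.compLinearMap fun _ => p), fun x => by simp [hu]⟩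

/-- An `m`-linear map that determines `f`. -/
noncomputable def HomPoly.rep {m : ℕ} (f : HomPoly K E F m) :
    MultilinearMap K (fun _ : Fin m => E) F := f.2.choose

theorem HomPoly.rep_spec {m : ℕ} (f : HomPoly K E F m) (x : E) :
    f.1 x = f.rep fun _ => x := f.2.choose_spec x

/-- The differential of a homogeneous polynomial `f`, determined by `u`, at the point `x` in the
direction `v`: the sum `u (v, x, …, x) + u (x, v, x, …, x) + ⋯ + u (x, …, x, v)`. -/
noncomputable def HomPoly.differential {m : ℕ} (f : HomPoly K E F m) (x : E) : E →ₗ[K] F :=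
  (f.rep.linearDeriv fun _ => x).comp (LinearMap.pi fun _ => LinearMap.id)

/-- A polynomial function with vector coefficients that vanishes on an infinite field has zero
coefficients. -/
theorem coeff_eq_zero_of_forall [Infinite K] (m : ℕ) (b : ℕ → F)
    (h : ∀ t : K, ∑ i ∈ range m, t ^ i • b i = 0) (i : ℕ) (hi : i < m) : b i = 0 := by
  rw [← Module.forall_dual_apply_eq_zero_iff K]
  intro φ
  have hp : (∑ i ∈ range m, Polynomial.C (φ (b i)) * Polynomial.X ^ i : Polynomial K) = 0 := by
    apply Polynomial.funext
    intro t
    have := congrArg φ (h t)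
    simp only [map_sum, map_smul, smul_eq_mul, map_zero] at this
    simp only [Polynomial.eval_finsetSum, Polynomial.eval_mul, Polynomial.eval_C,
      Polynomial.eval_pow, Polynomial.eval_X, Polynomial.eval_zero]
    rw [← this]
    exact sum_congr rfl fun i _ => mul_comm _ _
  have := congrArg (fun p => Polynomial.coeff p i) hp
  simpa [Polynomial.finsetSum_coeff, Polynomial.coeff_C_mul, Polynomial.coeff_X_pow, hi]
    using this

theorem linearDeriv_eq_zero [Infinite K] {ι : Type*} [Fintype ι] [DecidableEq ι]
    (u : MultilinearMap K (fun _ : ι => E) F) (hu : ∀ x, u (fun _ => x) = 0) (x v : E) :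
    u.linearDeriv (fun _ => x) (fun _ => v) = 0 := by
  let b : ℕ → F := fun k => ∑ s with #s = k, u (s.piecewise (fun _ => v) (fun _ => x))
  have hb : b 1 = u.linearDeriv (fun _ => x) (fun _ => v) := by
    have : (univ.filter fun s : Finset ι => #s = 1) = univ.map ⟨fun i => {i}, singleton_injective⟩ := by
      ext s
      simp [card_eq_one, eq_comm]
    simp only [b, this, sum_map, MultilinearMap.linearDeriv_apply]
    exact sum_congr rfl fun i _ => by simp [Finset.piecewise_singleton]
  rw [← hb]
  refine coeff_eq_zero_of_forall (K := K) (Fintype.card ι + 2) b ?_ 1 (by omega)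
  intro t
  have h := hu (t • v + x)
  have h2 : (fun _ : ι => t • v + x) = (fun _ => t • v) + (fun _ => x) := rfl
  rw [h2, MultilinearMap.map_add_univ] at h
  rw [← h]
  have h3 : ∀ s : Finset ι, u (s.piecewise (fun _ => t • v) (fun _ => x))
      = t ^ #s • u (s.piecewise (fun _ => v) (fun _ => x)) := by
    intro s
    have := u.map_piecewise_smul (fun _ => t) (s.piecewise (fun _ => v) (fun _ => x)) s
    rw [prod_const] at this
    rw [← this]
    congr 1
    ext i
    by_cases hi : i ∈ s <;> simp [hi]
  simp only [h3, b, smul_sum]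
  rw [← sum_fiberwise_of_maps_to (s := univ) (t := range (Fintype.card ι + 2))
    (g := fun s : Finset ι => #s)]
  · refine sum_congr rfl fun k _ => sum_congr rfl fun s hs => ?_
    rw [(mem_filter.1 hs).2]
  · intro s _
    have := card_le_univ s
    simp
    omega

/-- The differential does not depend on the multilinear map that determines the polynomial. -/
theorem HomPoly.differential_eq [Infinite K] {ι : Type*} [Fintype ι] [DecidableEq ι] {m : ℕ}
    (h : Fintype.card ι = m)
    (f : HomPoly K E F m) (u : MultilinearMap K (fun _ : ι => E) F)
    (hu : ∀ x, f.1 x = u fun _ => x) (x v : E) :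
    f.differential x v = ∑ i, u (Function.update (fun _ => x) i v) := by
  let e := Fintype.equivFinOfCardEq h
  have key := linearDeriv_eq_zero (f.rep - u.domDomCongr e)
    (fun x => by simp [← f.rep_spec, hu]) x v
  simp only [MultilinearMap.linearDeriv_apply, sub_apply, sum_sub_distrib,
    sub_eq_zero] at key
  simp only [differential, LinearMap.comp_apply, MultilinearMap.linearDeriv_apply,
    LinearMap.pi_apply, LinearMap.id_apply]
  rw [key, ← e.sum_comp]
  refine sum_congr rfl fun i _ => ?_
  simp only [MultilinearMap.domDomCongr_apply]
  congr 1
  ext j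
  by_cases hj : j = i
  · subst hj; simp
  · simp [hj]

theorem HomPoly.differential_bilin [Infinite K] (β : F →ₗ[K] G →ₗ[K] H) {m n s : ℕ}
    (f : HomPoly K E F m) (g : HomPoly K E G n) (h : HomPoly K E H s) (hs : s = m + n)
    (hh : ∀ x, h.1 x = β (f.1 x) (g.1 x)) (x v : E) :
    h.differential x v = β (f.differential x v) (g.1 x) + β (f.1 x) (g.differential x v) := by
  rw [h.differential_eq (ι := Fin m ⊕ Fin n) (by simp [hs]) (multilinearProd β f.rep g.rep)
    (fun x => by rw [hh, rep_spec f, rep_spec g]; rfl),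
    f.differential_eq (by simp) f.rep f.rep_spec, g.differential_eq (by simp) g.rep g.rep_spec]
  rw [f.rep_spec, g.rep_spec]
  simp only [Fintype.sum_sum_type, multilinearProd, MultilinearMap.coe_mk, map_sum,
    LinearMap.sum_apply]
  congr 1
  · refine sum_congr rfl fun i _ => ?_
    congr 2
    congr 1
    ext j; by_cases hj : j = i <;> simp [Function.update_apply]
  · refine sum_congr rfl fun i _ => ?_
    congr 2
    ext j; by_cases hj : j = i <;> simp [Function.update_apply]

theorem HomPoly.differential_add [Infinite K] {m : ℕ} (f g : HomPoly K E F m) (x v : E) :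
    (f + g).differential x v = f.differential x v + g.differential x v := by
  rw [(f + g).differential_eq (by simp) (f.rep + g.rep)
    (fun x => by simp [← rep_spec]),
    f.differential_eq (by simp) f.rep f.rep_spec, g.differential_eq (by simp) g.rep g.rep_spec]
  simp [sum_add_distrib]

theorem HomPoly.differential_smul [Infinite K] {m : ℕ} (c : K) (f : HomPoly K E F m) (x v : E) :
    (c • f).differential x v = c • f.differential x v := by
  rw [(c • f).differential_eq (by simp) (c • f.rep)
    (fun x => by simp [← rep_spec]),
    f.differential_eq (by simp) f.rep f.rep_spec]
  simp [smul_sum]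

/-- The differential as a linear function of the polynomial. -/
noncomputable def HomPoly.differentialₗ [Infinite K] (m : ℕ) (x v : E) : HomPoly K E F m →ₗ[K] F where
  toFun f := f.differential x v
  map_add' f g := HomPoly.differential_add f g x v
  map_smul' c f := HomPoly.differential_smul c f x v

theorem HomPoly.differential_zero_degree (f : HomPoly K E F 0) (x v : E) :
    f.differential x v = 0 := by
  simp [differential]

/-- The multilinear map that determines the differential of `x ↦ u (x, …, x)`. -/
def gradMulti {k : ℕ} (u : MultilinearMap K (fun _ : Fin (k + 1) => E) F) :
    MultilinearMap K (fun _ : Fin k => E) (E →ₗ[K] F) :=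
  ∑ i : Fin (k + 1),
    { toFun := fun w =>
        { toFun := fun v => u.curryMid i v w
          map_add' := fun a b => by simp only [map_add, add_apply]
          map_smul' := fun c a => by simp only [map_smul, smul_apply, RingHom.id_apply] }
      map_update_add' := fun w j a b => by
        ext v
        exact (u.curryMid i v).map_update_add w j a b
      map_update_smul' := fun w j c a => by
        ext v
        exact (u.curryMid i v).map_update_smul w j c a }

theorem gradMulti_apply {k : ℕ} (u : MultilinearMap K (fun _ : Fin (k + 1) => E) F)
    (w : Fin k → E) (v : E) : gradMulti u w v = ∑ i : Fin (k + 1), u (i.insertNth v w) := by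
  simp [gradMulti, LinearMap.sum_apply]

theorem insertNth_const {V : Type*} {k : ℕ} (i : Fin (k + 1)) (v x : V) :
    (i.insertNth v (fun _ => x) : Fin (k + 1) → V) = Function.update (fun _ => x) i v := by
  ext j
  induction j using i.succAboveCases <;> simp

theorem HomPoly.differential_mem [Infinite K] {k : ℕ} (f : HomPoly K E F (k + 1)) :
    f.differential ∈ homPoly K E (E →ₗ[K] F) k := by
  refine ⟨gradMulti f.rep, fun x => ?_⟩
  ext v
  rw [gradMulti_apply, f.differential_eq (by simp) f.rep f.rep_spec]
  simp only [insertNth_const]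

theorem HomPoly.apply_differential_mem [Infinite K] {m r s : ℕ} (hs : s + 1 = r + m)
    (f : HomPoly K E F m) (ξ : HomPoly K E E r) :
    (fun x => f.differential x (ξ.1 x)) ∈ homPoly K E F s := by
  cases m with
  | zero =>
    simp only [differential_zero_degree]
    exact zero_mem _
  | succ k =>
    obtain rfl : s = k + r := by omega
    exact homPoly_bilin_mem LinearMap.id f.differential_mem ξ.2

/-- The second differential of a homogeneous polynomial. -/
noncomputable def HomPoly.differential2 [Infinite K] :
    {m : ℕ} → HomPoly K E F m → E → E → E → F
  | 0, _, _, _, _ => 0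
  | k + 1, f, x, v, w => HomPoly.differential (⟨f.differential, f.differential_mem⟩ : HomPoly K E (E →ₗ[K] F) k) x v w

theorem HomPoly.differential2_symm [Infinite K] {m : ℕ} (f : HomPoly K E F m) (x v w : E) :
    f.differential2 x v w = f.differential2 x w v := by
  cases m with
  | zero => rfl
  | succ k =>
    have key : ∀ v w, f.differential2 x v w = ∑ i : Fin (k + 1), ∑ j : Fin (k + 1), if j = i then 0
        else f.rep (Function.update (Function.update (fun _ => x) i w) j v) := by
      intro v w
      simp only [differential2]
      rw [HomPoly.differential_eq (by simp) _ (gradMulti f.rep), LinearMap.sum_apply]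
      · simp only [gradMulti_apply]
        rw [sum_comm]
        refine sum_congr rfl fun i _ => ?_
        rw [Fin.sum_univ_succAbove _ i]
        simp only [if_true, zero_add, Fin.succAbove_ne, if_false]
        refine sum_congr rfl fun j _ => ?_
        congr 1
        ext l
        induction l using i.succAboveCases with
        | x => simp [Function.update_of_ne]
        | p l => by_cases hl : l = j <;> simp [hl]
      · intro x
        ext v
        rw [gradMulti_apply, f.differential_eq (by simp) f.rep f.rep_spec]
        simp only [insertNth_const]
    rw [key, key, sum_comm]
    refine sum_congr rfl fun i _ => sum_congr rfl fun j _ => ?_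
    by_cases h : i = j
    · simp [h]
    · rw [if_neg h, if_neg (Ne.symm h), Function.update_comm h]

theorem HomPoly.differential_apply_differential [Infinite K] {m r s : ℕ} (hs : s + 1 = r + m)
    (f : HomPoly K E F m) (ξ : HomPoly K E E r) (h : HomPoly K E F s)
    (hh : ∀ x, h.1 x = f.differential x (ξ.1 x)) (x v : E) :
    h.differential x v = f.differential2 x v (ξ.1 x) + f.differential x (ξ.differential x v) := by
  cases m with
  | zero =>
    have : h = 0 := by
      ext x
      simp [hh, differential_zero_degree]
    subst this
    simp only [differential_zero_degree, differential2, add_zero]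
    exact map_zero (HomPoly.differentialₗ s x v)
  | succ k =>
    exact HomPoly.differential_bilin LinearMap.id (⟨f.differential, f.differential_mem⟩ : HomPoly K E (E →ₗ[K] F) k) ξ h
      (by omega) hh x v

end HomogeneousFacts

section Series

variable (K E F : Type*) [Field K] [AddCommGroup E] [Module K E] [AddCommGroup F] [Module K F]

/-- The space `F[[E]]` of formal series with variables in `E` and coefficients in `F`: the product
over all degrees `m` of the spaces of homogeneous polynomials of degree `m`. -/
def FormalSeries : Type _ := ∀ m : ℕ, HomPoly K E F m

instance : AddCommGroup (FormalSeries K E F) :=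
  inferInstanceAs (AddCommGroup (∀ m : ℕ, HomPoly K E F m))

instance : Module K (FormalSeries K E F) :=
  inferInstanceAs (Module K (∀ m : ℕ, HomPoly K E F m))

end Series

namespace FormalSeries

variable {K E F G H : Type*} [Field K] [AddCommGroup E] [Module K E] [AddCommGroup F] [Module K F]
  [AddCommGroup G] [Module K G] [AddCommGroup H] [Module K H]

/-- The homogeneous component of degree `m` of a formal series. -/
def component (f : FormalSeries K E F) (m : ℕ) : HomPoly K E F m := f m

/-- The formal series with given homogeneous components. -/
def mk (f : ℕ → E → F) (hf : ∀ m, f m ∈ homPoly K E F m) : FormalSeries K E F :=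
  fun m => ⟨f m, hf m⟩

@[ext] theorem ext {f g : FormalSeries K E F} (h : ∀ m x, (f.component m).1 x = (g.component m).1 x) :
    f = g :=
  funext fun m => Subtype.ext (funext (h m))

@[simp] theorem component_mk (f : ℕ → E → F) (hf : ∀ m, f m ∈ homPoly K E F m) (m : ℕ) :
    (mk f hf).component m = ⟨f m, hf m⟩ := rfl

@[simp] theorem component_add (f g : FormalSeries K E F) (m : ℕ) :
    (f + g).component m = f.component m + g.component m := rfl

@[simp] theorem component_sub (f g : FormalSeries K E F) (m : ℕ) :
    (f - g).component m = f.component m - g.component m := rfl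

@[simp] theorem component_smul (c : K) (f : FormalSeries K E F) (m : ℕ) :
    (c • f).component m = c • f.component m := rfl

@[simp] theorem component_zero (m : ℕ) : (0 : FormalSeries K E F).component m = 0 := rfl

/-- The homogeneous component of degree `m`, as a linear map. -/
def componentₗ (m : ℕ) : FormalSeries K E F →ₗ[K] HomPoly K E F m where
  toFun f := f.component m
  map_add' _ _ := rfl
  map_smul' _ _ := rfl

theorem sum_mem {ι : Type*} (t : Finset ι) {m : ℕ} (f : ι → E → F)
    (h : ∀ i ∈ t, f i ∈ homPoly K E F m) : (fun x => ∑ i ∈ t, f i x) ∈ homPoly K E F m := by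
  have := Submodule.sum_mem _ h
  convert this using 1
  ext x
  simp

/-- The derivative `ξ.f` of the formal series `f ∈ F[[E]]` along the formal series `ξ ∈ E[[E]]`.
Its component of degree `s` is the sum, over `r + m - 1 = s`, of the derivatives `ξ_r.f_m`, where
`(ξ_r.f_m)(x) = u (ξ_r x, x, …, x) + ⋯ + u (x, …, x, ξ_r x)` if `u` determines `f_m`. -/
noncomputable def derivAlong [Infinite K] (ξ : FormalSeries K E E) (f : FormalSeries K E F) :
    FormalSeries K E F :=
  mk (fun s x => ∑ p ∈ antidiagonal (s + 1), (f.component p.2).differential x ((ξ.component p.1).1 x))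
    fun _ => sum_mem _ _ fun p hp =>
      HomPoly.apply_differential_mem (mem_antidiagonal.1 hp).symm (f.component p.2) (ξ.component p.1)

theorem derivAlong_comp [Infinite K] (ξ : FormalSeries K E E) (f : FormalSeries K E F) (s : ℕ)
    (x : E) : ((derivAlong ξ f).component s).1 x =
      ∑ p ∈ antidiagonal (s + 1), (f.component p.2).differential x ((ξ.component p.1).1 x) := rfl

theorem derivAlong_add [Infinite K] (ξ : FormalSeries K E E) (f g : FormalSeries K E F) :
    derivAlong ξ (f + g) = derivAlong ξ f + derivAlong ξ g := by
  ext s x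
  simp [derivAlong_comp, HomPoly.differential_add, sum_add_distrib]

theorem derivAlong_smul [Infinite K] (c : K) (ξ : FormalSeries K E E) (f : FormalSeries K E F) :
    derivAlong ξ (c • f) = c • derivAlong ξ f := by
  ext s x
  simp [derivAlong_comp, HomPoly.differential_smul, smul_sum]

theorem add_derivAlong [Infinite K] (ξ η : FormalSeries K E E) (f : FormalSeries K E F) :
    derivAlong (ξ + η) f = derivAlong ξ f + derivAlong η f := by
  ext s x
  simp [derivAlong_comp, sum_add_distrib]

theorem smul_derivAlong [Infinite K] (c : K) (ξ : FormalSeries K E E) (f : FormalSeries K E F) :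
    derivAlong (c • ξ) f = c • derivAlong ξ f := by
  ext s x
  simp [derivAlong_comp, smul_sum]

/-- Derivation of formal series, as a bilinear map. -/
noncomputable def derivAlongₗ [Infinite K] :
    FormalSeries K E E →ₗ[K] FormalSeries K E F →ₗ[K] FormalSeries K E F :=
  LinearMap.mk₂ K derivAlong add_derivAlong smul_derivAlong derivAlong_add derivAlong_smul

theorem sum_antidiagonal_assoc {M : Type*} [AddCommMonoid M] (n : ℕ) (G : ℕ → ℕ → ℕ → M) :
    ∑ p ∈ antidiagonal n, ∑ q ∈ antidiagonal p.2, G p.1 q.1 q.2 =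
      ∑ p ∈ antidiagonal n, ∑ q ∈ antidiagonal p.1, G q.1 q.2 p.2 := by
  simp only [Finset.sum_sigma']
  refine Finset.sum_nbij' (fun ⟨⟨i, _⟩, ⟨k, l⟩⟩ ↦ ⟨(i + k, l), (i, k)⟩)
    (fun ⟨⟨_, j⟩, ⟨k, l⟩⟩ ↦ ⟨(k, l + j), (l, j)⟩) ?_ ?_ ?_ ?_ ?_ <;>
    simp +contextual [add_assoc]
  all_goals grind

theorem sum_antidiagonal_swap_left {M : Type*} [AddCommMonoid M] (n : ℕ) (G : ℕ → ℕ → ℕ → M) :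
    ∑ p ∈ antidiagonal n, ∑ q ∈ antidiagonal p.2, G p.1 q.1 q.2 =
      ∑ p ∈ antidiagonal n, ∑ q ∈ antidiagonal p.2, G q.1 p.1 q.2 := by
  rw [sum_antidiagonal_assoc, sum_antidiagonal_assoc n fun a b c => G b a c]
  exact sum_congr rfl fun p _ => Finset.Nat.sum_antidiagonal_swap.symm

theorem sum_antidiagonal_shift {M : Type*} [AddCommMonoid M] (s : ℕ) (G : ℕ → ℕ → ℕ → M)
    (hG : ∀ a, G a 0 0 = 0) :
    ∑ p ∈ antidiagonal (s + 1), ∑ q ∈ antidiagonal (p.2 + 1), G p.1 q.1 q.2 =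
      ∑ p ∈ antidiagonal (s + 2), ∑ q ∈ antidiagonal p.2, G p.1 q.1 q.2 := by
  rw [Finset.Nat.sum_antidiagonal_succ' (n := s + 1)]
  simp [hG]

theorem sum_antidiagonal_shift' {M : Type*} [AddCommMonoid M] (s : ℕ) (G : ℕ → ℕ → ℕ → M)
    (hG : ∀ a, G 0 0 a = 0) :
    ∑ p ∈ antidiagonal (s + 1), ∑ q ∈ antidiagonal (p.1 + 1), G q.1 q.2 p.2 =
      ∑ p ∈ antidiagonal (s + 2), ∑ q ∈ antidiagonal p.2, G p.1 q.1 q.2 := by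
  rw [sum_antidiagonal_assoc, Finset.Nat.sum_antidiagonal_succ (n := s + 1)]
  simp [hG]

theorem differential_of_eq_sum [Infinite K] {ι : Type*} (t : Finset ι) {m : ℕ} (f : ι → E → F)
    (h : ∀ i ∈ t, f i ∈ homPoly K E F m) (g : HomPoly K E F m)
    (hg : ∀ x, g.1 x = ∑ i ∈ t, f i x) (x v : E) :
    g.differential x v = ∑ i ∈ t.attach, HomPoly.differential (⟨f i, h i i.2⟩ : HomPoly K E F m) x v := by
  have : g = ∑ i ∈ t.attach, (⟨f i, h i i.2⟩ : HomPoly K E F m) := by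
    ext x
    rw [hg, ← sum_attach]
    simp
  rw [this]
  exact map_sum (HomPoly.differentialₗ m x v) _ _

theorem differential_derivAlong [Infinite K] (ξ : FormalSeries K E E) (f : FormalSeries K E F)
    (s : ℕ) (x v : E) : ((derivAlong ξ f).component s).differential x v =
      ∑ p ∈ antidiagonal (s + 1), ((f.component p.2).differential2 x v ((ξ.component p.1).1 x) +
        (f.component p.2).differential x ((ξ.component p.1).differential x v)) := by
  rw [differential_of_eq_sum (antidiagonal (s + 1))
    (fun p x => (f.component p.2).differential x ((ξ.component p.1).1 x))
    (fun p hp => HomPoly.apply_differential_mem (mem_antidiagonal.1 hp).symm _ _) _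
    (derivAlong_comp ξ f s), ← sum_attach (antidiagonal (s + 1))]
  exact sum_congr rfl fun p _ =>
    HomPoly.differential_apply_differential (mem_antidiagonal.1 p.2).symm _ _ _ (fun _ => rfl) x v

/-- The derivation along a bracket is the commutator of the derivations. -/
theorem derivAlong_bracket [Infinite K] (ξ η : FormalSeries K E E) (f : FormalSeries K E F) :
    derivAlong (derivAlong ξ η - derivAlong η ξ) f =
      derivAlong ξ (derivAlong η f) - derivAlong η (derivAlong ξ f) := by
  have h1 : ∀ (ξ η : FormalSeries K E E) (s : ℕ) (x : E),
      ((derivAlong ξ (derivAlong η f)).component s).1 x =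
        ∑ p ∈ antidiagonal (s + 2), ∑ q ∈ antidiagonal p.2,
          (f.component q.2).differential2 x ((ξ.component p.1).1 x) ((η.component q.1).1 x) +
        ((derivAlong (derivAlong ξ η) f).component s).1 x := by
    intro ξ η s x
    simp only [derivAlong_comp, differential_derivAlong, sum_add_distrib, map_sum]
    congr 1
    · exact sum_antidiagonal_shift s (fun a b c =>
        (f.component c).differential2 x ((ξ.component a).1 x) ((η.component b).1 x)) fun a => rfl
    · rw [sum_antidiagonal_shift s (fun a b c =>
        (f.component c).differential x ((η.component b).differential x ((ξ.component a).1 x))) fun a => by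
          rw [HomPoly.differential_zero_degree],
        ← sum_antidiagonal_shift' s (fun a b c =>
        (f.component c).differential x ((η.component b).differential x ((ξ.component a).1 x))) fun a => by
          rw [HomPoly.differential_zero_degree, map_zero]]
  rw [sub_eq_add_neg, ← neg_one_smul K, add_derivAlong, smul_derivAlong, neg_one_smul,
    ← sub_eq_add_neg]
  ext s x
  have e1 := h1 ξ η s x
  have e2 := h1 η ξ s x
  have e3 := sum_antidiagonal_swap_left (s + 2) (fun a b c =>
    (f.component c).differential2 x ((ξ.component a).1 x) ((η.component b).1 x))
  simp only [(f.component _).differential2_symm x ((ξ.component _).1 x)] at e3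
  simp only [(f.component _).differential2_symm x ((ξ.component _).1 x)] at e1
  simp only [component_sub, AddSubgroupClass.coe_sub, Pi.sub_apply]
  rw [e1, e2, e3]
  abel

end FormalSeries

section SelfSeries

variable (K X : Type*) [Field K] [AddCommGroup X] [Module K X]

/-- The space `S(X) = X[[X]]` of formal series with variables and coefficients in `X`. -/
def SelfSeries : Type _ := FormalSeries K X X

instance : AddCommGroup (SelfSeries K X) := inferInstanceAs (AddCommGroup (FormalSeries K X X))

instance : Module K (SelfSeries K X) := inferInstanceAs (Module K (FormalSeries K X X))

end SelfSeries

namespace SelfSeries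

variable {K X : Type*} [Field K] [AddCommGroup X] [Module K X]

/-- An element of `S(X)`, seen as a formal series with variables and coefficients in `X`. -/
def toSeries : SelfSeries K X ≃ₗ[K] FormalSeries K X X := LinearEquiv.refl K (FormalSeries K X X)

variable [Infinite K]

/-- The bracket of `S(X)`: `[ξ, η] = ξ.η - η.ξ`. -/
noncomputable instance : Bracket (SelfSeries K X) (SelfSeries K X) where
  bracket ξ η := toSeries.symm ((toSeries ξ).derivAlong (toSeries η) -
    (toSeries η).derivAlong (toSeries ξ))

theorem toSeries_lie (ξ η : SelfSeries K X) : toSeries ⁅ξ, η⁆ =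
    (toSeries ξ).derivAlong (toSeries η) - (toSeries η).derivAlong (toSeries ξ) := rfl

noncomputable instance : LieRing (SelfSeries K X) where
  add_lie ξ η ζ := toSeries.injective (by
    simp only [toSeries_lie, map_add, FormalSeries.add_derivAlong, FormalSeries.derivAlong_add]
    abel)
  lie_add ξ η ζ := toSeries.injective (by
    simp only [toSeries_lie, map_add, FormalSeries.add_derivAlong, FormalSeries.derivAlong_add]
    abel)
  lie_self ξ := toSeries.injective (by simp [toSeries_lie])
  leibniz_lie ξ η ζ := toSeries.injective (by
    have h : ∀ ξ f g : FormalSeries K X X,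
        ξ.derivAlong (f - g) = ξ.derivAlong f - ξ.derivAlong g :=
      fun ξ f g => map_sub (FormalSeries.derivAlongₗ ξ) f g
    simp only [toSeries_lie, map_add, FormalSeries.derivAlong_bracket, h]
    abel)

noncomputable instance : LieAlgebra K (SelfSeries K X) where
  lie_smul c ξ η := toSeries.injective (by
    simp only [toSeries_lie, map_smul, FormalSeries.smul_derivAlong, FormalSeries.derivAlong_smul,
      smul_sub])

end SelfSeries

/-- A formal action of the Lie algebra `A` on the vector space `X`: a homomorphism of Lie algebras
from `A` to `S(X)`. -/
abbrev FormalAction (K A X : Type*) [Field K] [Infinite K] [LieRing A] [LieAlgebra K A]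
    [AddCommGroup X] [Module K X] : Type _ :=
  A →ₗ⁅K⁆ SelfSeries K X

namespace FormalSeries

section PointwiseBracket

variable {K Y A : Type*} [Field K] [AddCommGroup Y] [Module K Y] [LieRing A] [LieAlgebra K A]

/-- The pointwise bracket on `A[[Y]]`: the component of degree `s` of `[f, g]` is the sum over
`m + n = s` of `y ↦ [f_m y, g_n y]`. -/
instance : Bracket (FormalSeries K Y A) (FormalSeries K Y A) where
  bracket f g := mk (fun s y => ∑ p ∈ antidiagonal s, ⁅(f.component p.1).1 y, (g.component p.2).1 y⁆)
    fun s => sum_mem _ _ fun p hp => by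
      have := homPoly_bilin_mem (LieModule.toEnd K A A : A →ₗ[K] A →ₗ[K] A)
        (f.component p.1).2 (g.component p.2).2
      rw [mem_antidiagonal.1 hp] at this
      exact this

theorem lie_comp (f g : FormalSeries K Y A) (s : ℕ) (y : Y) :
    (⁅f, g⁆.component s).1 y = ∑ p ∈ antidiagonal s, ⁅(f.component p.1).1 y, (g.component p.2).1 y⁆ := rfl

instance : LieRing (FormalSeries K Y A) where
  add_lie f g h := by
    ext s y
    simp [lie_comp, sum_add_distrib]
  lie_add f g h := by
    ext s y
    simp [lie_comp, sum_add_distrib]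
  lie_self f := by
    ext s y
    rw [lie_comp, component_zero]
    have h : ∀ p ∈ antidiagonal s,
        ⁅(f.component p.1).1 y, (f.component p.2).1 y⁆ + ⁅(f.component p.2).1 y, (f.component p.1).1 y⁆ = 0 :=
      fun p _ => by rw [← lie_skew, neg_add_cancel]
    refine Finset.sum_involution (fun p _ => p.swap) (fun p hp => h p hp) ?_ ?_ ?_
    · rintro ⟨a, b⟩ _ hne heq
      obtain rfl : b = a := congrArg Prod.fst heq
      exact hne (lie_self _)
    · intro p hp
      exact HasAntidiagonal.mem_antidiagonal.2 ((add_comm _ _).trans (mem_antidiagonal.1 hp))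
    · intro p _
      exact p.swap_swap
  leibniz_lie f g h := by
    ext s y
    simp only [lie_comp, component_add, Submodule.coe_add, Pi.add_apply, lie_sum, sum_lie]
    have e1 := sum_antidiagonal_assoc s fun a b c =>
      ⁅⁅(f.component a).1 y, (g.component b).1 y⁆, (h.component c).1 y⁆
    have e2 := sum_antidiagonal_swap_left s fun a b c =>
      ⁅(g.component b).1 y, ⁅(f.component a).1 y, (h.component c).1 y⁆⁆
    rw [← e1, ← e2, ← sum_add_distrib]
    refine sum_congr rfl fun p _ => ?_
    rw [← sum_add_distrib]
    exact sum_congr rfl fun q _ => leibniz_lie _ _ _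

instance : LieAlgebra K (FormalSeries K Y A) where
  lie_smul c f g := by
    ext s y
    simp [lie_comp, smul_sum]

variable [Infinite K]

/-- The derivation along a formal series is a derivation of the Lie algebra `A[[Y]]`. -/
theorem derivAlong_lie (ξ : FormalSeries K Y Y) (f g : FormalSeries K Y A) :
    derivAlong ξ ⁅f, g⁆ = ⁅derivAlong ξ f, g⁆ + ⁅f, derivAlong ξ g⁆ := by
  have hd : ∀ (n : ℕ) (y v : Y), (⁅f, g⁆.component n).differential y v =
      ∑ p ∈ antidiagonal n, (⁅(f.component p.1).differential y v, (g.component p.2).1 y⁆ +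
        ⁅(f.component p.1).1 y, (g.component p.2).differential y v⁆) := by
    intro n y v
    have hm : ∀ p ∈ antidiagonal n, (fun y => ⁅(f.component p.1).1 y, (g.component p.2).1 y⁆) ∈
        homPoly K Y A n := by
      intro p hp
      have := homPoly_bilin_mem (LieModule.toEnd K A A : A →ₗ[K] A →ₗ[K] A)
        (f.component p.1).2 (g.component p.2).2
      rw [mem_antidiagonal.1 hp] at this
      exact this
    rw [differential_of_eq_sum (antidiagonal n) _ hm _ (lie_comp f g n),
      ← sum_attach (antidiagonal n)]
    exact sum_congr rfl fun p _ =>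
      HomPoly.differential_bilin (LieModule.toEnd K A A : A →ₗ[K] A →ₗ[K] A) (f.component p.1.1)
        (g.component p.1.2) _ (mem_antidiagonal.1 p.2).symm (fun _ => rfl) y v
  ext s y
  simp only [derivAlong_comp, component_add, Submodule.coe_add, Pi.add_apply, hd, sum_add_distrib,
    lie_comp, sum_lie, lie_sum]
  congr 1
  · rw [sum_antidiagonal_assoc (s + 1) fun a b c =>
      ⁅(f.component b).differential y ((ξ.component a).1 y), (g.component c).1 y⁆,
      Finset.Nat.sum_antidiagonal_succ (n := s)]
    simp [HomPoly.differential_zero_degree]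
  · rw [sum_antidiagonal_swap_left (s + 1) fun a b c =>
      ⁅(f.component b).1 y, (g.component c).differential y ((ξ.component a).1 y)⁆,
      Finset.Nat.sum_antidiagonal_succ' (n := s)]
    simp [HomPoly.differential_zero_degree]

end PointwiseBracket

end FormalSeries

section Wreath

variable {K B Y : Type*} (A : Type*) [Field K] [Infinite K] [LieRing A] [LieAlgebra K A]
  [LieRing B] [LieAlgebra K B] [AddCommGroup Y] [Module K Y]

/-- The homomorphism from `S(Y)` to the Lie algebra of derivations of `A[[Y]]`, which maps `ξ` to
the derivation `f ↦ ξ.f`. -/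
noncomputable def SelfSeries.toDerivation :
    SelfSeries K Y →ₗ⁅K⁆ LieDerivation K (FormalSeries K Y A) (FormalSeries K Y A) where
  toFun ξ :=
    { toLinearMap := FormalSeries.derivAlongₗ (toSeries ξ)
      leibniz' := fun f g => by
        have := FormalSeries.derivAlong_lie (toSeries ξ) f g
        rw [← lie_skew (FormalSeries.derivAlong (toSeries ξ) f) g, neg_add_eq_sub] at this
        exact this }
  map_add' ξ η := LieDerivation.ext fun f => FormalSeries.add_derivAlong _ _ f
  map_smul' c ξ := LieDerivation.ext fun f => FormalSeries.smul_derivAlong c _ f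
  map_lie' {ξ η} := LieDerivation.ext fun f => by
    rw [LieDerivation.commutator_apply]
    exact FormalSeries.derivAlong_bracket (toSeries ξ) (toSeries η) f

/-- The wreath product `W(A, B; d)` of the Lie algebras `A` and `B` relative to the formal action
`d` of `B` on `Y`: the semidirect product of `A[[Y]]` and `B`, with the bracket
`[(f, b), (g, c)] = ([f, g] + d_b.g - d_c.f, [b, c])`. -/
abbrev WreathProduct (d : FormalAction K B Y) : Type _ :=
  FormalSeries K Y A ⋊⁅(SelfSeries.toDerivation A).comp d⁆ B

end Wreath

namespace FormalSeries

variable {K E F X Y : Type*} [Field K] [AddCommGroup E] [Module K E] [AddCommGroup F] [Module K F]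
  [AddCommGroup X] [Module K X] [AddCommGroup Y] [Module K Y]

/-- Substitution of a formal series in a linear map: `f ↦ s ∘ f`. -/
def mapCoeff (s : E →ₗ[K] F) : FormalSeries K X E →ₗ[K] FormalSeries K X F where
  toFun f := mk (fun m x => s ((f.component m).1 x)) fun m => homPoly_comp_mem s LinearMap.id (f.component m).2
  map_add' f g := ext fun m x => s.map_add ((f.component m).1 x) ((g.component m).1 x)
  map_smul' c f := ext fun m x => s.map_smul c ((f.component m).1 x)

/-- Substitution of a linear map in a formal series: `f ↦ f ∘ p`. -/
def mapVar (p : Y →ₗ[K] X) : FormalSeries K X E →ₗ[K] FormalSeries K Y E where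
  toFun f := mk (fun m y => (f.component m).1 (p y)) fun m => homPoly_comp_mem LinearMap.id p (f.component m).2
  map_add' _ _ := rfl
  map_smul' _ _ := rfl

theorem uncurry_mem (n m : ℕ) (g : HomPoly K Y (FormalSeries K X F) n) :
    (fun z : X × Y => ((g.1 z.2).component m).1 z.1) ∈ homPoly K (X × Y) F (m + n) := by
  obtain ⟨u, hu⟩ := g.2
  let diag : MultilinearMap K (fun _ : Fin m => X) F →ₗ[K] HomPoly K X F m :=
    { toFun := fun v => ⟨fun x => v fun _ => x, v, fun _ => rfl⟩
      map_add' := fun _ _ => rfl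
      map_smul' := fun _ _ => rfl }
  have hdiag : LinearMap.range diag = ⊤ := LinearMap.range_eq_top.2 fun f =>
    ⟨f.rep, Subtype.ext (funext fun x => (f.rep_spec x).symm)⟩
  obtain ⟨σ, hσ⟩ := diag.exists_rightInverse_of_surjective hdiag
  let w : MultilinearMap K (fun _ : Fin n => X × Y) (MultilinearMap K (fun _ : Fin m => X × Y) F) :=
    ((MultilinearMap.compLinearMapₗ fun _ : Fin m => LinearMap.fst K X Y) ∘ₗ σ ∘ₗ
      componentₗ m).compMultilinearMap (u.compLinearMap fun _ => LinearMap.snd K X Y)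
  have hw := homPoly_mem_of_card (ι := Fin n ⊕ Fin m) (m := m + n) (by simp [add_comm])
    (MultilinearMap.uncurrySum (N := fun _ : Fin n ⊕ Fin m => X × Y) w)
  convert hw using 2 with z
  have h2 := congrArg (fun f : HomPoly K X F m => f.1 z.1)
    (LinearMap.congr_fun hσ ((g.1 z.2).component m))
  rw [hu] at h2 ⊢
  exact h2.symm

/-- The canonical identification of a formal series `g ∈ F[[X]][[Y]]` with a formal series in
`F[[X × Y]]`, by `g(x, y) = g(y)(x)`: the component of degree `r` is the sum over `m + n = r` of
the bihomogeneous polynomials `(x, y) ↦ g_n(y)_m(x)`. -/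
def uncurry : FormalSeries K Y (FormalSeries K X F) →ₗ[K] FormalSeries K (X × Y) F where
  toFun g := mk
    (fun r z => ∑ p ∈ antidiagonal r, (((g.component p.2).1 z.2).component p.1).1 z.1)
    fun r => sum_mem _ _ fun p hp => by
      have := uncurry_mem p.2 p.1 (g.component p.2)
      rw [mem_antidiagonal.1 hp] at this
      exact this
  map_add' f g := ext fun r z => sum_add_distrib (s := antidiagonal r)
    (f := fun p => (((f.component p.2).1 z.2).component p.1).1 z.1)
    (g := fun p => (((g.component p.2).1 z.2).component p.1).1 z.1)
  map_smul' c f := by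
    ext r z
    change ∑ p ∈ antidiagonal r, c • (((f.component p.2).1 z.2).component p.1).1 z.1 =
      c • ∑ p ∈ antidiagonal r, (((f.component p.2).1 z.2).component p.1).1 z.1
    rw [smul_sum]

end FormalSeries

section Triangular

variable {K A B X Y : Type*} [Field K] [AddCommGroup X] [Module K X] [AddCommGroup Y] [Module K Y]

/-- The canonical embedding of `S(X)[[Y]]`, identified with `X[[X × Y]]`, in `S(X × Y)`, by means
of the inclusion of `X` in `X × Y`. -/
def embedDouble : FormalSeries K Y (SelfSeries K X) →ₗ[K] SelfSeries K (X × Y) :=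
  SelfSeries.toSeries.symm.toLinearMap ∘ₗ FormalSeries.mapCoeff (LinearMap.inl K X Y) ∘ₗ
    FormalSeries.uncurry ∘ₗ FormalSeries.mapCoeff SelfSeries.toSeries.toLinearMap

/-- The canonical embedding of `S(Y)` in `S(X × Y)`: `η` is mapped to `(x, y) ↦ (0, η(y))`. -/
def embedSnd : SelfSeries K Y →ₗ[K] SelfSeries K (X × Y) :=
  SelfSeries.toSeries.symm.toLinearMap ∘ₗ FormalSeries.mapCoeff (LinearMap.inr K X Y) ∘ₗ
    FormalSeries.mapVar (LinearMap.snd K X Y) ∘ₗ SelfSeries.toSeries.toLinearMap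

variable [Infinite K] [LieRing A] [LieAlgebra K A] [LieRing B] [LieAlgebra K B]

/-- The canonical prolongation `a ↦ D_a`, from `A[[Y]]` to `S(X × Y)`, of a formal action `D` of `A`
on `X`: the series `a` is substituted in the linear map `D`, and the result, an element of
`S(X)[[Y]]`, is seen in `S(X × Y)`. -/
noncomputable def FormalAction.prolong (D : FormalAction K A X) :
    FormalSeries K Y A →ₗ[K] SelfSeries K (X × Y) :=
  embedDouble ∘ₗ FormalSeries.mapCoeff (D : A →ₗ[K] SelfSeries K X)

end Triangular

/-! Elements of `S(X × Y)` behave like vector fields. The field `D_f` points along `X`, with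
coefficients that depend on both variables; the field `d_b` points along `Y` and depends on `y`
alone. Since brackets in the semidirect product are bilinear, three relations suffice: `[d_b, d_c] =
d_[b,c]` (`embedSnd_lie`), `[d_b, D_f] = D_(d_b.f)` (`prolong_derivAlong`) and `[D_f, D_g] =
D_[f,g]` (`prolong_lie`). In the second, `D_f.d_b = 0` because `d_b` does not see `x`, and `d_b.D_f`
differentiates only the coefficients `f`, on which `D` depends linearly. In the third, `y` is a mere
parameter: differentiating `D_g` along `D_f` takes place in `S(X)` at fixed `y`, and `D` is a
homomorphism there. What remains is to compute differentials and to match degrees. The differential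
of `D_f` is found without a multilinear map that determines it: on a line it is the coefficient of
`t`, and an infinite field separates coefficients (`differential_eq_sum_of_line`). A derivation
lowers the total degree by one, so the index sets on the two sides differ by boundary terms; these
contain the differential of a constant and vanish. -/

namespace HomPoly

/-! ### Differentials read off on lines -/

variable {K E F G H : Type*} [Field K] [AddCommGroup E] [Module K E] [AddCommGroup F] [Module K F]
  [AddCommGroup G] [Module K G] [AddCommGroup H] [Module K H]

/-- The restriction of a homogeneous polynomial to a line is a polynomial function, the coefficient
of degree one of which is the differential. -/
theorem exists_line_expansion [Infinite K] {m : ℕ} (f : HomPoly K E F m) (x v : E) :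
    ∃ c : ℕ → F, c 1 = f.differential x v ∧
      ∀ N, m < N → ∀ t : K, f.1 (x + t • v) = ∑ i ∈ range N, t ^ i • c i := by
  -- By multilinearity, the coefficient of `t ^ k` collects the ways of putting `v` in `k` of the
  -- `m` places and `x` in the others.
  refine ⟨fun k => ∑ s : Finset (Fin m) with #s = k,
    f.rep (s.piecewise (fun _ => v) (fun _ => x)), ?_, fun N hN t => ?_⟩
  · have h : (univ.filter fun s : Finset (Fin m) => #s = 1) =
        univ.map ⟨fun i => {i}, singleton_injective⟩ := by
      ext s
      simp [card_eq_one, eq_comm]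
    rw [f.differential_eq (by simp) f.rep f.rep_spec]
    simp only [h, sum_map]
    exact sum_congr rfl fun i _ => by simp [Finset.piecewise_singleton]
  · have h : (fun _ : Fin m => x + t • v) = (fun _ => t • v) + (fun _ => x) := by
      ext
      simp [add_comm]
    rw [f.rep_spec, h, MultilinearMap.map_add_univ]
    have h3 : ∀ s : Finset (Fin m), f.rep (s.piecewise (fun _ => t • v) (fun _ => x))
        = t ^ #s • f.rep (s.piecewise (fun _ => v) (fun _ => x)) := by
      intro s
      have := f.rep.map_piecewise_smul (fun _ => t) (s.piecewise (fun _ => v) (fun _ => x)) s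
      rw [prod_const] at this
      rw [← this]
      congr 1
      ext i
      by_cases hi : i ∈ s <;> simp [hi]
    simp only [h3, smul_sum]
    rw [← sum_fiberwise_of_maps_to (s := univ) (t := range N) (g := fun s : Finset (Fin m) => #s)]
    · refine sum_congr rfl fun k _ => sum_congr rfl fun s hs => ?_
      rw [(mem_filter.1 hs).2]
    · intro s _
      have := card_le_univ s
      simp only [Fintype.card_fin] at this
      simp only [mem_range]
      omega

/-- The differential of a homogeneous polynomial in a given direction only depends on its
restriction to a line. -/
theorem differential_eq_sum_of_line [Infinite K] {ι : Type*} (s : Finset ι) {m : ℕ}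
    (h : HomPoly K E F m) (n : ι → ℕ) (f : ∀ i, HomPoly K G H (n i)) (L : ι → H →ₗ[K] F)
    (x v : E) (y w : G) (hl : ∀ t : K, h.1 (x + t • v) = ∑ i ∈ s, L i ((f i).1 (y + t • w))) :
    h.differential x v = ∑ i ∈ s, L i ((f i).differential y w) := by
  obtain ⟨c, hc, hc'⟩ := h.exists_line_expansion x v
  choose b hb hb' using fun i => (f i).exists_line_expansion y w
  -- One bound above `m` and every `n i` with `i ∈ s`; the `2` keeps the index `1` in range even
  -- when all these degrees are zero.
  let N := m + ∑ i ∈ s, n i + 2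
  have key := coeff_eq_zero_of_forall (K := K) N (fun k => c k - ∑ i ∈ s, L i (b i k)) ?_ 1
    (by omega)
  · simpa only [hc, hb, sub_eq_zero] using key
  · intro t
    have := hl t
    rw [hc' N (by omega), ← sub_eq_zero] at this
    rw [← this]
    simp only [smul_sub, sum_sub_distrib, smul_sum]
    rw [sum_comm]
    congr 1
    refine sum_congr rfl fun i hi => ?_
    have hn : n i ≤ ∑ i ∈ s, n i := single_le_sum (fun _ _ => Nat.zero_le _) hi
    rw [hb' i N (by omega)]
    simp

theorem differential_eq_of_line [Infinite K] {m n : ℕ}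
    (h : HomPoly K E F m) (f : HomPoly K G H n) (L : H →ₗ[K] F)
    (x v : E) (y w : G) (hl : ∀ t : K, h.1 (x + t • v) = L (f.1 (y + t • w))) :
    h.differential x v = L (f.differential y w) := by
  simpa using differential_eq_sum_of_line {()} h (fun _ => n) (fun _ => f) (fun _ => L) x v y w
    (by simpa using hl)

end HomPoly

/-! ### Evaluation and fourfold sums over degrees -/

namespace FormalSeries

/-- Evaluation of the homogeneous component of degree `m` at a point, as a linear map. -/
def evalComponent {K E F : Type*} [Field K] [AddCommGroup E] [Module K E] [AddCommGroup F]
    [Module K F] (m : ℕ) (x : E) : FormalSeries K E F →ₗ[K] F :=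
  LinearMap.proj x ∘ₗ (homPoly K E F m).subtype ∘ₗ componentₗ m

/-- The exchange of the two middle indices is its own inverse, hence the same map in both
directions. In `derivAlong_prolong` it turns a grouping by series (`f` or `g`) into a grouping by
variable (`X` or `Y`). -/
theorem sum_antidiagonal_four {M : Type*} [AddCommMonoid M] (n : ℕ) (G : ℕ → ℕ → ℕ → ℕ → M) :
    ∑ p ∈ antidiagonal n, ∑ q ∈ antidiagonal p.1, ∑ r ∈ antidiagonal p.2, G q.1 q.2 r.1 r.2 =
      ∑ p ∈ antidiagonal n, ∑ q ∈ antidiagonal p.1, ∑ r ∈ antidiagonal p.2, G q.1 r.1 q.2 r.2 := by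
  simp only [Finset.sum_sigma']
  refine Finset.sum_nbij' (fun ⟨_, ⟨⟨i, j⟩, ⟨k, l⟩⟩⟩ ↦ ⟨(i + k, j + l), ⟨(i, k), (j, l)⟩⟩)
    (fun ⟨_, ⟨⟨i, j⟩, ⟨k, l⟩⟩⟩ ↦ ⟨(i + k, j + l), ⟨(i, k), (j, l)⟩⟩) ?_ ?_ ?_ ?_ ?_
  all_goals simp
  all_goals grind

end FormalSeries

/-! ### Components and differentials of the embedded series -/

section Triangular
open SelfSeries FormalSeries

variable {K A B X Y : Type*} [Field K] [AddCommGroup X] [Module K X] [AddCommGroup Y] [Module K Y]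

theorem embedSnd_comp (η : SelfSeries K Y) (r : ℕ) (z : X × Y) :
    ((toSeries (embedSnd (X := X) η)).component r).1 z =
      (0, ((toSeries η).component r).1 z.2) := rfl

variable [Infinite K] [LieRing A] [LieAlgebra K A] [LieRing B] [LieAlgebra K B]

theorem embedSnd_differential (η : SelfSeries K Y) (r : ℕ) (z v : X × Y) :
    ((toSeries (embedSnd (X := X) η)).component r).differential z v =
      (0, ((toSeries η).component r).differential z.2 v.2) :=
  HomPoly.differential_eq_of_line _ ((toSeries η).component r) (LinearMap.inr K X Y) z v z.2 v.2
    fun _ => rfl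

theorem FormalAction.prolong_comp (D : FormalAction K A X) (f : FormalSeries K Y A) (r : ℕ)
    (z : X × Y) : ((toSeries (D.prolong f)).component r).1 z =
      (∑ p ∈ antidiagonal r, ((toSeries (D ((f.component p.2).1 z.2))).component p.1).1 z.1, 0) :=
  rfl

/-- Product rule for `D_(f(y))(x)`: the direction splits into a part along `X`, which differentiates
the series `D_a`, and a part along `Y`, which passes through the linear map `D` and differentiates
`f`. -/
theorem FormalAction.prolong_differential (D : FormalAction K A X) (f : FormalSeries K Y A)
    (r : ℕ) (z v : X × Y) : ((toSeries (D.prolong f)).component r).differential z v =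
      (∑ p ∈ antidiagonal r,
        (((toSeries (D ((f.component p.2).1 z.2))).component p.1).differential z.1 v.1 +
          ((toSeries (D ((f.component p.2).differential z.2 v.2))).component p.1).1 z.1), 0) := by
  obtain ⟨x, y⟩ := z
  obtain ⟨v, w⟩ := v
  -- With `y` fixed, each summand is a polynomial in `x` of degree `p.1`, in general smaller than
  -- `r`.
  have h1 := HomPoly.differential_eq_sum_of_line (antidiagonal r)
    ((toSeries (D.prolong f)).component r) (fun p => p.1)
    (fun p => (toSeries (D ((f.component p.2).1 y))).component p.1)
    (fun _ => LinearMap.inl K X Y) (x, y) (v, 0) x v fun t => by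
      rw [prolong_comp]
      simp only [Prod.mk_add_mk, Prod.smul_mk, smul_zero, add_zero]
      rw [← map_sum (LinearMap.inl K X Y)]
      rfl
  -- With `x` fixed, `a ↦ (D_a)_m(x)` is linear, so each summand is a linear image of the component
  -- of `f` of degree `p.2`.
  have h2 := HomPoly.differential_eq_sum_of_line (antidiagonal r)
    ((toSeries (D.prolong f)).component r) (fun p => p.2) (fun p => f.component p.2)
    (fun p => LinearMap.inl K X Y ∘ₗ evalComponent p.1 x ∘ₗ toSeries.toLinearMap ∘ₗ
      (D : A →ₗ[K] SelfSeries K X)) (x, y) (0, w) y w fun t => by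
      rw [prolong_comp]
      simp only [LinearMap.comp_apply]
      rw [← map_sum]
      simp only [Prod.mk_add_mk, Prod.smul_mk, smul_zero, add_zero]
      rfl
  have hv : ((v, w) : X × Y) = (v, 0) + (0, w) := by simp
  rw [hv, map_add, h1, h2]
  simp only [LinearMap.comp_apply]
  rw [← map_sum, ← map_sum, ← map_add, ← sum_add_distrib]
  simp only [Prod.mk_add_mk, add_zero, zero_add]
  rfl

/-! ### The three bracket relations -/

/-- Neither the components nor the differentials of the embedded series involve the `X` coordinate,
so already the derivative of one along the other is computed in `Y`. -/
theorem embedSnd_lie (ξ η : SelfSeries K Y) :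
    embedSnd (X := X) ⁅ξ, η⁆ = ⁅embedSnd (X := X) ξ, embedSnd (X := X) η⁆ := by
  have h : ∀ ξ η : SelfSeries K Y,
      (toSeries (embedSnd (X := X) ξ)).derivAlong (toSeries (embedSnd (X := X) η)) =
        toSeries (embedSnd (X := X) (toSeries.symm ((toSeries ξ).derivAlong (toSeries η)))) := by
    intro ξ η
    ext r z
    · rw [derivAlong_comp]
      simp only [embedSnd_differential, embedSnd_comp, Prod.fst_sum, sum_const_zero]
    · rw [derivAlong_comp]
      simp only [embedSnd_differential, embedSnd_comp, Prod.snd_sum]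
      rfl
  apply toSeries.injective
  rw [toSeries_lie, h, h, ← map_sub, ← map_sub, ← map_sub, ← toSeries_lie]
  rfl

/-- The direction `D_f` has no `Y` coordinate, and the differential of `d_b` sees only that
coordinate. -/
theorem derivAlong_prolong_embedSnd (D : FormalAction K A X) (f : FormalSeries K Y A)
    (ξ : SelfSeries K Y) :
    (toSeries (D.prolong f)).derivAlong (toSeries (embedSnd (X := X) ξ)) = 0 := by
  refine FormalSeries.ext fun r z => ?_
  rw [derivAlong_comp]
  simp only [embedSnd_differential, FormalAction.prolong_comp, map_zero]
  trans 0
  · exact sum_eq_zero fun _ _ => rfl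
  · rfl

theorem FormalAction.prolong_derivAlong (D : FormalAction K A X) (f : FormalSeries K Y A)
    (ξ : SelfSeries K Y) :
    D.prolong ((toSeries ξ).derivAlong f) = ⁅embedSnd (X := X) ξ, D.prolong f⁆ := by
  apply toSeries.injective
  rw [toSeries_lie, derivAlong_prolong_embedSnd, sub_zero]
  refine FormalSeries.ext fun s z => ?_
  rw [prolong_comp, derivAlong_comp]
  simp only [embedSnd_comp, prolong_differential, map_zero, zero_add, derivAlong_comp]
  refine Prod.ext ?_ (by simp [Prod.snd_sum])
  simp only [Prod.fst_sum]
  -- Here `m` is the degree in `x` of the series given by `D`, `a` the degree of the component of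
  -- `ξ`, and `n` that of the component of `f`.
  let G : ℕ → ℕ → ℕ → X := fun m a n => ((toSeries (D ((f.component n).differential z.2
    (((toSeries ξ).component a).1 z.2)))).component m).1 z.1
  have hG : ∀ m a, G m a 0 = 0 := fun m a => by
    simp only [G, HomPoly.differential_zero_degree, map_zero]
    rfl
  have h := sum_antidiagonal_swap_left (s + 1) G
  -- The split-off term has `m = s + 1` and `a = n = 0`; it vanishes by `hG`, and the rest is
  -- indexed by the degrees of `D_(ξ.f)`.
  rw [Finset.Nat.sum_antidiagonal_succ' (n := s)] at h
  simp only [Finset.Nat.antidiagonal_zero, sum_singleton, hG, zero_add] at h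
  rw [← h]
  refine sum_congr rfl fun p _ => ?_
  exact map_sum (evalComponent p.1 z.1 ∘ₗ toSeries.toLinearMap ∘ₗ (D : A →ₗ[K] SelfSeries K X)) _ _

/-- The direction `D_f` lies along `X`, so only the first half of `prolong_differential` survives
and `y` stays a parameter. -/
theorem FormalAction.derivAlong_prolong (D : FormalAction K A X) (f g : FormalSeries K Y A)
    (s : ℕ) (z : X × Y) :
    (((toSeries (D.prolong f)).derivAlong (toSeries (D.prolong g))).component s).1 z =
      (∑ p ∈ antidiagonal s, ∑ q ∈ antidiagonal p.2,
        (((toSeries (D ((f.component q.1).1 z.2))).derivAlong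
          (toSeries (D ((g.component q.2).1 z.2)))).component p.1).1 z.1, 0) := by
  rw [derivAlong_comp]
  simp only [prolong_comp, prolong_differential, map_zero]
  refine Prod.ext ?_ (by simp [Prod.snd_sum])
  simp only [Prod.fst_sum]
  -- The indices `p`, `q` are the degrees of the `f` factor in `x` and `y`; `m`, `n` are those of
  -- the `g` factor.
  let G : ℕ → ℕ → ℕ → ℕ → X := fun p q m n =>
    ((toSeries (D ((g.component n).1 z.2))).component m).differential z.1
      (((toSeries (D ((f.component q).1 z.2))).component p).1 z.1)
  have h := sum_antidiagonal_four (s + 1) G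
  -- After regrouping, the split-off term has total `X` degree `p + m = 0`. Then `m = 0`, a constant
  -- is differentiated, and the term vanishes; the shift left over is the one in the definition of
  -- the derivation in `S(X)`.
  rw [Finset.Nat.sum_antidiagonal_succ (n := s)
    (f := fun p => ∑ q ∈ antidiagonal p.1, ∑ r ∈ antidiagonal p.2, G q.1 r.1 q.2 r.2)] at h
  have hG : ∀ p q n, G p q 0 n = 0 := fun p q n => HomPoly.differential_zero_degree _ _ _
  simp only [Finset.Nat.antidiagonal_zero, sum_singleton, hG, sum_const_zero, zero_add] at h
  trans ∑ p ∈ antidiagonal (s + 1), ∑ q ∈ antidiagonal p.1, ∑ r ∈ antidiagonal p.2,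
      G q.1 q.2 r.1 r.2
  · refine sum_congr rfl fun p _ => ?_
    rw [sum_comm]
    refine sum_congr rfl fun r _ => ?_
    simp only [map_sum]
    simp [G, FormalSeries.component]
    rfl
  · rw [h]
    refine sum_congr rfl fun p _ => ?_
    rw [sum_comm]
    rfl

theorem FormalAction.prolong_lie (D : FormalAction K A X) (f g : FormalSeries K Y A) :
    D.prolong ⁅f, g⁆ = ⁅D.prolong f, D.prolong g⁆ := by
  apply toSeries.injective
  rw [toSeries_lie]
  refine FormalSeries.ext fun s z => ?_
  rw [component_sub, AddSubgroupClass.coe_sub, Pi.sub_apply, D.derivAlong_prolong f g,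
    D.derivAlong_prolong g f, prolong_comp]
  refine Prod.ext ?_ (sub_zero (0 : Y)).symm
  rw [Prod.fst_sub]
  dsimp only
  rw [← sum_sub_distrib]
  refine sum_congr rfl fun p _ => ?_
  -- The swap makes `q.1` the degree of `f` and `q.2` that of `g` in both sums, so that their
  -- difference is a sum of brackets in `S(X)`.
  have h : ∑ q ∈ antidiagonal p.2, (((toSeries (D ((g.component q.1).1 z.2))).derivAlong
        (toSeries (D ((f.component q.2).1 z.2)))).component p.1).1 z.1 =
      ∑ q ∈ antidiagonal p.2, (((toSeries (D ((g.component q.2).1 z.2))).derivAlong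
        (toSeries (D ((f.component q.1).1 z.2)))).component p.1).1 z.1 :=
    Finset.Nat.sum_antidiagonal_swap.symm
  rw [h, ← sum_sub_distrib, lie_comp]
  refine (map_sum (evalComponent p.1 z.1 ∘ₗ toSeries.toLinearMap ∘ₗ
    (D : A →ₗ[K] SelfSeries K X)) _ _).trans (sum_congr rfl fun q _ => ?_)
  simp only [LinearMap.comp_apply]
  -- The only use of the compatibility of `D` with brackets; the other relations need just its
  -- linearity.
  erw [LieHom.map_lie]
  rfl

/-! ### The triangular action -/

/-- The triangular action of the wreath product on `X × Y`. -/
noncomputable def FormalAction.wreath (D : FormalAction K A X) (d : FormalAction K B Y) :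
    FormalAction K (WreathProduct A d) (X × Y) where
  toFun w := D.prolong w.left + embedSnd (d w.right)
  map_add' v w := by
    simp only [LieAlgebra.SemiDirectSum.add_eq_mk, map_add]
    abel
  map_smul' c w := by
    simp only [LieAlgebra.SemiDirectSum.smul_eq_mk, map_smul, smul_add, RingHom.id_apply]
  map_lie' {v w} := by
    have h : ∀ (b : B) (f : FormalSeries K Y A), D.prolong
        (((SelfSeries.toDerivation A).comp d) b f) = ⁅embedSnd (X := X) (d b), D.prolong f⁆ :=
      fun b f => D.prolong_derivAlong f (d b)
    simp only [LieAlgebra.SemiDirectSum.lie_eq_mk, map_add, map_sub, h, LieHom.map_lie,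
      embedSnd_lie, D.prolong_lie, add_lie, lie_add]
    -- The cross term `[D_f, d_c]` becomes `-[d_c, D_f]`, which is the source of `-d_c.f` in the
    -- bracket of the wreath product.
    rw [← lie_skew (D.prolong v.left) (embedSnd (d w.right))]
    abel

end Triangular

theorem mainTheorem3 {K : Type*} [Field K] [Infinite K]
    {A B X Y : Type*} [LieRing A] [LieAlgebra K A] [LieRing B] [LieAlgebra K B]
    [AddCommGroup X] [Module K X] [AddCommGroup Y] [Module K Y]
    (D : FormalAction K A X) (d : FormalAction K B Y) :
    ∃ Δ : FormalAction K (WreathProduct A d) (X × Y),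
      (∀ (f : FormalSeries K Y A) (b : B), Δ ⟨f, b⟩ = D.prolong f + embedSnd (d b)) ∧
      ∀ (f : FormalSeries K Y A) (b : B) (r : ℕ) (x : X) (y : Y),
        ((SelfSeries.toSeries (Δ ⟨f, b⟩)).component r).1 (x, y) =
          (∑ p ∈ Finset.HasAntidiagonal.antidiagonal r,
            ((SelfSeries.toSeries (D ((f.component p.2).1 y))).component p.1).1 x,
           ((SelfSeries.toSeries (d b)).component r).1 y) := by
  refine ⟨D.wreath d, fun _ _ => rfl, fun f b r x y => ?_⟩
  change ((SelfSeries.toSeries (D.prolong f)).component r).1 (x, y) +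
    ((SelfSeries.toSeries (embedSnd (d b))).component r).1 (x, y) = _
  rw [D.prolong_comp, embedSnd_comp]
  simp
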